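/- Let $\mathcal V$ be a finite set of nodes partitioned into layers $\mathcal O_1,\dots,\mathcal O_L$, where the last layer $\mathcal O_L=\{D\}$ consists of a single destination node and $\mathcal O_1$ may contain several nodes (the sources). For $1\le l\le L-1$ let $\rho_l:2^{\mathcal O_l}\times 2^{\mathcal O_{l+1}}\to[0,\infty)$ be functions such that, for all $U,U_1,U_2\subseteq\mathcal O_l$ and $V,V_1,V_2\subseteq\mathcal O_{l+1}$: 1. $\rho_l(U_1\cup U_2,V_1\cap V_2)+\rho_l(U_1\cap U_2,V_1\cup V_2)\le\rho_l(U_1,V_1)+\rho_l(U_2,V_2)$; 2. $\rho_l(U,V)\le\rho_l(U_1,V_1)$ whenever $U\cup V\subseteq U_1\cup V_1$; 3. $\rho_l(U,V)=0$ if $U=\emptyset$ or $V=\emptyset$. For $f:\mathcal V\to[0,\infty)$ and $A\subseteq\mathcal V$ write $f(A)=\sum_{v\in A}f(v)$. A node-flow is a function $f:\mathcal V\to[0,\infty)$ such that $f(\mathcal O_1)=f(D)$ and $$f(V)-f(\mathcal O_l\setminus U)\le\rho_l(U,V)\qquad\text{for all }1\le l\le L-1,\ U\subseteq\mathcal O_l,\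 V\subseteq\mathcal O_{l+1}.$$ For $\Omega\subseteq\mathcal V$ put $\Omega_l=\Omega\cap\mathcal O_l$ and define the cut function $C(\Omega)=\sum_{l=1}^{L-1}\rho_l(\Omega_l,\mathcal O_{l+1}\setminus\Omega_{l+1})$. Then given nonnegative source values $\{f(v):v\in\mathcal O_1\}$ are feasible, i.e. they extend to a node-flow $f$ on $\mathcal V$, if and only if $$f(\Omega_1)\le C(\Omega)\qquad\text{for all }\Omega\subseteq\mathcal V\text{ with }D\notin\Omega.$$ -/

import Mathlib

/-- A layered graph on the finite node set `V`: the nodes are partitioned into the layers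
`O 1, …, O L`. Edges only join consecutive layers and play no further role, so they are not
recorded. -/
structure LayeredGraph (V : Type*) where
  /-- the number of layers -/
  L : ℕ
  /-- the index of the layer that contains a node -/
  layerOf : V → ℕ
  one_le_layerOf : ∀ v, 1 ≤ layerOf v
  layerOf_le : ∀ v, layerOf v ≤ L

/-- The `l`-th layer, as a finite set of nodes. -/
def LayeredGraph.O {V : Type*} [Fintype V] (G : LayeredGraph V) (l : ℕ) : Finset V :=
  Finset.univ.filter (fun v => G.layerOf v = l)

/-- A family of bisubmodular capacity functions `ρ l : 2 ^ O l × 2 ^ O (l + 1) → [0, ∞)`,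
for `1 ≤ l ≤ L - 1`. Values of `ρ l A B` at other arguments are unconstrained and never used. -/
structure BisubmodularCapacity {V : Type*} [Fintype V] [DecidableEq V] (G : LayeredGraph V) where
  ρ : ℕ → Finset V → Finset V → ℝ
  nonneg : ∀ l ∈ Finset.Ico 1 G.L, ∀ A ⊆ G.O l, ∀ B ⊆ G.O (l + 1), 0 ≤ ρ l A B
  bisubmodular : ∀ l ∈ Finset.Ico 1 G.L,
    ∀ A₁ ⊆ G.O l, ∀ A₂ ⊆ G.O l, ∀ B₁ ⊆ G.O (l + 1), ∀ B₂ ⊆ G.O (l + 1),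
      ρ l (A₁ ∪ A₂) (B₁ ∩ B₂) + ρ l (A₁ ∩ A₂) (B₁ ∪ B₂) ≤ ρ l A₁ B₁ + ρ l A₂ B₂
  mono : ∀ l ∈ Finset.Ico 1 G.L,
    ∀ A ⊆ G.O l, ∀ A₁ ⊆ G.O l, ∀ B ⊆ G.O (l + 1), ∀ B₁ ⊆ G.O (l + 1),
      A ∪ B ⊆ A₁ ∪ B₁ → ρ l A B ≤ ρ l A₁ B₁
  empty : ∀ l ∈ Finset.Ico 1 G.L, ∀ A ⊆ G.O l, ∀ B ⊆ G.O (l + 1),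
    A = ∅ ∨ B = ∅ → ρ l A B = 0

/-- The cut function `C(Ω) = ∑_{l = 1}^{L - 1} ρ l (Ω ∩ O l) (O (l + 1) \ Ω)`. -/
def BisubmodularCapacity.cut {V : Type*} [Fintype V] [DecidableEq V] {G : LayeredGraph V}
    (c : BisubmodularCapacity G) (Ω : Finset V) : ℝ :=
  ∑ l ∈ Finset.Ico 1 G.L, c.ρ l (Ω ∩ G.O l) (G.O (l + 1) \ (Ω ∩ G.O (l + 1)))

/-- A node-flow with sources the nodes of the first layer and destination `D`: a nonnegative
function on the nodes that satisfies the capacity constraints and for which the destination sinks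
the whole flow of the first layer. -/
structure BisubmodularCapacity.IsNodeFlow {V : Type*} [Fintype V] [DecidableEq V]
    {G : LayeredGraph V} (c : BisubmodularCapacity G) (D : V) (f : V → ℝ) : Prop where
  nonneg : ∀ v, 0 ≤ f v
  capacity : ∀ l ∈ Finset.Ico 1 G.L, ∀ A ⊆ G.O l, ∀ B ⊆ G.O (l + 1),
    ∑ v ∈ B, f v - ∑ v ∈ G.O l \ A, f v ≤ c.ρ l A B
  sink : ∑ v ∈ G.O 1, f v = f D

/-- Prescribed source values on the first layer are feasible if they extend to a node-flow. -/
def BisubmodularCapacity.Feasible {V : Type*} [Fintype V] [DecidableEq V]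
    {G : LayeredGraph V} (c : BisubmodularCapacity G) (D : V) (s : {v // v ∈ G.O 1} → ℝ) : Prop :=
  ∃ f : V → ℝ, c.IsNodeFlow D f ∧ ∀ v : {v // v ∈ G.O 1}, f v = s v

/-! Necessity: the capacity inequalities along a cut telescope. Sufficiency is dynamic programming
on cuts, backwards from `D`. Let g_l(W) be the least value of a cut of the layers from l on whose
part in layer l is W, so that g_l(W) = min over U of ρ_l(W, U's complement) + g_{l+1}(U).
Bisubmodularity makes this minimand jointly submodular, so every g_l is a polymatroid rank function.
A flow f ≤ g_l on layer l then passes to layer l+1: the new values must obey both g_{l+1} and the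
rank function induced by f and ρ_l, and polymatroid intersection supplies a common vector of total
f(V), since its min-max condition is f ≤ g_l rewritten. At l = 1 the bound is the cut condition. -/

/-- A monotone submodular set function that vanishes at the empty set. -/
structure IsPolymatroidRank {V : Type*} [DecidableEq V] (h : Finset V → ℝ) : Prop where
  mono : ∀ A B, A ⊆ B → h A ≤ h B
  submodular : ∀ A B, h (A ∪ B) + h (A ∩ B) ≤ h A + h B
  empty : h ∅ = 0

/-- Fixing the value `t` at the element `e` turns the constraints `x A ≤ h A` into constraints on
the remaining elements that are again given by a polymatroid rank function. -/
theorem IsPolymatroidRank.fixValue {V : Type*} [DecidableEq V] {h : Finset V → ℝ}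
    (hh : IsPolymatroidRank h) (e : V) (t : ℝ) (ht : t ≤ h {e}) :
    IsPolymatroidRank (fun A => min (h A) (h (insert e A) - t)) where
  mono A B hAB := min_le_min (hh.mono _ _ hAB)
    (sub_le_sub_right (hh.mono _ _ (Finset.insert_subset_insert e hAB)) t)
  submodular A B := by
    have h1 := hh.submodular A B
    have h2 := hh.submodular A (insert e B)
    have h3 := hh.submodular (insert e A) B
    have h4 := hh.submodular (insert e A) (insert e B)
    have i2 := hh.mono (A ∩ B) (A ∩ insert e B)
      (Finset.inter_subset_inter_left (Finset.subset_insert e B))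
    have i3 := hh.mono (A ∩ B) (insert e A ∩ B)
      (Finset.inter_subset_inter_right (Finset.subset_insert e A))
    rw [Finset.union_insert] at h2
    rw [Finset.insert_union] at h3
    rw [← Finset.insert_union_distrib, ← Finset.insert_inter_distrib] at h4
    have a1 := min_le_left (h (A ∪ B)) (h (insert e (A ∪ B)) - t)
    have a2 := min_le_right (h (A ∪ B)) (h (insert e (A ∪ B)) - t)
    have b1 := min_le_left (h (A ∩ B)) (h (insert e (A ∩ B)) - t)
    have b2 := min_le_right (h (A ∩ B)) (h (insert e (A ∩ B)) - t)
    -- In the mixed cases the union takes the branch with `e` and the intersection the branch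
    -- without, at the cost of one use of monotonicity.
    rcases min_choice (h A) (h (insert e A) - t) with hA | hA <;>
    rcases min_choice (h B) (h (insert e B) - t) with hB | hB <;>
    simp only [hA, hB] <;> linarith
  empty := by
    have : (0 : ℝ) ≤ h (insert e ∅) - t := by simpa using ht
    simp only [hh.empty, min_eq_left this]

/-- The polymatroid intersection theorem. -/
theorem exists_le_inf_of_le_add_sdiff {V : Type*} [DecidableEq V] (E : Finset V) :
    ∀ (h g : Finset V → ℝ) (k : ℝ), IsPolymatroidRank h → IsPolymatroidRank g →
      (∀ B ⊆ E, k ≤ h B + g (E \ B)) →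
      ∃ x : V → ℝ, (∀ v, 0 ≤ x v) ∧ (∀ B ⊆ E, ∑ v ∈ B, x v ≤ h B) ∧
        (∀ B ⊆ E, ∑ v ∈ B, x v ≤ g B) ∧ k ≤ ∑ v ∈ E, x v := by
  induction E using Finset.induction_on with
  | empty =>
    intro h g k hh hg hk
    refine ⟨0, fun v => le_rfl, ?_, ?_, ?_⟩
    · intro B hB
      rw [Finset.subset_empty.1 hB, Finset.sum_empty, hh.empty]
    · intro B hB
      rw [Finset.subset_empty.1 hB, Finset.sum_empty, hg.empty]
    · simpa [hh.empty, hg.empty] using hk ∅ le_rfl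
  | insert e E he ih =>
    intro h g k hh hg hk
    have hk1 : ∀ B ⊆ E, k ≤ h (insert e B) + g (E \ B) := fun B hB => by
      have := hk (insert e B) (Finset.insert_subset_insert e hB)
      rwa [Finset.insert_sdiff_insert, Finset.sdiff_insert_of_notMem he] at this
    have hk2 : ∀ B ⊆ E, k ≤ h B + g (insert e (E \ B)) := fun B hB => by
      have := hk B (hB.trans (Finset.subset_insert e E))
      rwa [Finset.insert_sdiff_of_notMem _ (fun h => he (hB h))] at this
    -- `t` will be the value at `e`. The condition for the reduced problem on `E` with target `k -
    -- t` splits into four: two free of `t` (`hk1`, `hk2`), a lower bound on `t` (`htl`) and an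
    -- upper bound (`htu`). The least nonnegative `t` meeting the lower bounds is chosen.
    obtain ⟨B₀, hB₀, hmax⟩ := E.powerset.exists_max_image (fun B => k - h B - g (E \ B))
      ⟨∅, by simp⟩
    rw [Finset.mem_powerset] at hB₀
    set t := max 0 (k - h B₀ - g (E \ B₀)) with ht
    have ht0 : 0 ≤ t := le_max_left _ _
    have htl : ∀ B ⊆ E, k - h B - g (E \ B) ≤ t := fun B hB =>
      (hmax B (Finset.mem_powerset.2 hB)).trans (le_max_right _ _)
    have hth : t ≤ h {e} := by
      refine max_le ?_ ?_
      · rw [← hh.empty]; exact hh.mono _ _ (Finset.empty_subset _)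
      · have h1 := hh.submodular {e} B₀
        rw [← Finset.insert_eq] at h1
        have h2 := hh.mono ∅ ({e} ∩ B₀) (Finset.empty_subset _)
        linarith [hk1 B₀ hB₀, hh.empty]
    have htg : t ≤ g {e} := by
      refine max_le ?_ ?_
      · rw [← hg.empty]; exact hg.mono _ _ (Finset.empty_subset _)
      · have h1 := hg.submodular {e} (E \ B₀)
        rw [← Finset.insert_eq] at h1
        have h2 := hg.mono ∅ ({e} ∩ (E \ B₀)) (Finset.empty_subset _)
        linarith [hk2 B₀ hB₀, hg.empty]
    have htu : ∀ B ⊆ E, t ≤ h (insert e B) + g (insert e (E \ B)) - k := by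
      intro B hB
      refine max_le ?_ ?_
      · have := hh.mono _ _ (Finset.subset_insert e B)
        linarith [hk2 B hB]
      -- Uncrossing: the tight set `B₀` and `insert e B` are replaced by their union, which contains
      -- `e`, and their intersection, which does not; `hk1` and `hk2` apply to these.
      · have h1 := hh.submodular B₀ (insert e B)
        have h2 := hg.submodular (E \ B₀) (insert e (E \ B))
        have e1 : B₀ ∩ insert e B = B₀ ∩ B :=
          Finset.inter_insert_of_notMem (fun h => he (hB₀ h))
        have e2 : (E \ B₀) ∩ insert e (E \ B) = E \ (B₀ ∪ B) := by
          rw [Finset.inter_insert_of_notMem (fun h => he (Finset.sdiff_subset h)),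
            Finset.sdiff_union_distrib]
        have e3 : (E \ B₀) ∪ (E \ B) = E \ (B₀ ∩ B) := (Finset.sdiff_inter_distrib_right ..).symm
        rw [Finset.union_insert, e1] at h1
        rw [Finset.union_insert, e2, e3] at h2
        have h3 := hk1 (B₀ ∪ B) (Finset.union_subset hB₀ hB)
        have h4 := hk2 (B₀ ∩ B) (Finset.inter_subset_left.trans hB₀)
        linarith
    obtain ⟨x, hx0, hxh, hxg, hxk⟩ := ih _ _ (k - t) (hh.fixValue e t hth) (hg.fixValue e t htg) (by
      intro B hB
      have c1 := htl B hB
      have c2 := hk1 B hB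
      have c3 := hk2 B hB
      have c4 := htu B hB
      rcases min_choice (h B) (h (insert e B) - t) with hA | hA <;>
      rcases min_choice (g (E \ B)) (g (insert e (E \ B)) - t) with hB | hB <;>
      simp only [hA, hB] <;> linarith)
    have hsum : ∀ B ⊆ E, ∑ v ∈ B, Function.update x e t v = ∑ v ∈ B, x v := fun B hB =>
      Finset.sum_update_of_notMem (fun h => he (hB h)) _ _
    have key : ∀ p : Finset V → ℝ,
        (∀ B ⊆ E, ∑ v ∈ B, x v ≤ min (p B) (p (insert e B) - t)) →
        ∀ B ⊆ insert e E, ∑ v ∈ B, Function.update x e t v ≤ p B := by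
      intro p hp B hB
      by_cases heB : e ∈ B
      · have hB' : B.erase e ⊆ E := Finset.subset_insert_iff.1 hB
        have := (hp _ hB').trans (min_le_right _ _)
        rw [Finset.insert_erase heB] at this
        rw [← Finset.add_sum_erase _ _ heB, hsum _ hB', Function.update_self]
        linarith
      · have hB' : B ⊆ E := (Finset.subset_insert_iff_of_notMem heB).1 hB
        rw [hsum _ hB']
        exact (hp _ hB').trans (min_le_left _ _)
    refine ⟨Function.update x e t, ?_, key h hxh, key g hxg, ?_⟩
    · intro v
      by_cases hv : v = e
      · subst hv; simpa using ht0
      · simpa [hv] using hx0 v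
    · rw [Finset.sum_insert he, hsum _ le_rfl, Function.update_self]
      linarith

/-- Partial minimization of a jointly submodular function preserves submodularity. -/
theorem IsPolymatroidRank.exists_minConvolution {V : Type*} [Fintype V] [DecidableEq V]
    {ψ : Finset V → Finset V → ℝ} {p : Finset V → ℝ} (hp : IsPolymatroidRank p)
    (mono : ∀ X Y A, X ⊆ Y → ψ X A ≤ ψ Y A)
    (submodular : ∀ X Y A B, ψ (X ∪ Y) (A ∪ B) + ψ (X ∩ Y) (A ∩ B) ≤ ψ X A + ψ Y B)
    (empty : ∀ A, ψ ∅ A = 0) :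
    ∃ q : Finset V → ℝ, IsPolymatroidRank q ∧ (∀ X A, q X ≤ ψ X A + p A) ∧
      ∀ X, ∃ A, q X = ψ X A + p A := by
  choose m hm using fun X => Finite.exists_min (fun A => ψ X A + p A)
  refine ⟨fun X => ψ X (m X) + p (m X), ⟨?_, ?_, ?_⟩, fun X A => hm X A, fun X => ⟨m X, rfl⟩⟩
  · intro X Y hXY
    exact (hm X (m Y)).trans (add_le_add_left (mono _ _ _ hXY) _)
  · intro X Y
    have h1 := hm (X ∪ Y) (m X ∪ m Y)
    have h2 := hm (X ∩ Y) (m X ∩ m Y)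
    have h3 := submodular X Y (m X) (m Y)
    have h4 := hp.submodular (m X) (m Y)
    linarith
  · have h1 := hm ∅ ∅
    have h2 := hp.mono ∅ (m ∅) (Finset.empty_subset _)
    simp only [empty, hp.empty] at h1 h2 ⊢
    linarith

/-- A nonnegative modular function is a polymatroid rank function. -/
theorem isPolymatroidRank_sum {V : Type*} [DecidableEq V] {f : V → ℝ} (hf : ∀ v, 0 ≤ f v) :
    IsPolymatroidRank (fun A => ∑ v ∈ A, f v) where
  mono _ _ hAB := Finset.sum_le_sum_of_subset_of_nonneg hAB fun v _ _ => hf v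
  submodular _ _ := Finset.sum_union_inter.le
  empty := Finset.sum_empty

/-! ### Passing a flow from one layer to the next -/

theorem LayeredGraph.mem_O {V : Type*} [Fintype V] (G : LayeredGraph V) {l : ℕ} {v : V} :
    v ∈ G.O l ↔ G.layerOf v = l := by
  simp [LayeredGraph.O]

/-- The capacity function between layers `l` and `l + 1`, extended to all pairs of node sets. -/
def BisubmodularCapacity.ext {V : Type*} [Fintype V] [DecidableEq V] {G : LayeredGraph V}
    (c : BisubmodularCapacity G) (l : ℕ) (A B : Finset V) : ℝ :=
  c.ρ l (A ∩ G.O l) (B ∩ G.O (l + 1))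

namespace BisubmodularCapacity

variable {V : Type*} [Fintype V] [DecidableEq V] {G : LayeredGraph V} (c : BisubmodularCapacity G)

theorem ext_mono {l : ℕ} (hl : l ∈ Finset.Ico 1 G.L) {A A' B B' : Finset V} (hA : A ⊆ A')
    (hB : B ⊆ B') : c.ext l A B ≤ c.ext l A' B' :=
  c.mono l hl _ Finset.inter_subset_right _ Finset.inter_subset_right _ Finset.inter_subset_right _
    Finset.inter_subset_right (Finset.union_subset_union (Finset.inter_subset_inter_right hA)
      (Finset.inter_subset_inter_right hB))

theorem ext_bisubmodular {l : ℕ} (hl : l ∈ Finset.Ico 1 G.L) (A A' B B' : Finset V) :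
    c.ext l (A ∪ A') (B ∩ B') + c.ext l (A ∩ A') (B ∪ B') ≤ c.ext l A B + c.ext l A' B' := by
  have := c.bisubmodular l hl (A ∩ G.O l) Finset.inter_subset_right (A' ∩ G.O l)
    Finset.inter_subset_right (B ∩ G.O (l + 1)) Finset.inter_subset_right (B' ∩ G.O (l + 1))
    Finset.inter_subset_right
  rwa [← Finset.union_inter_distrib_right, ← Finset.union_inter_distrib_right,
    ← Finset.inter_inter_distrib_right, ← Finset.inter_inter_distrib_right] at this

theorem ext_eq_zero {l : ℕ} (hl : l ∈ Finset.Ico 1 G.L) {A B : Finset V}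
    (h : A ∩ G.O l = ∅ ∨ B ∩ G.O (l + 1) = ∅) : c.ext l A B = 0 :=
  c.empty l hl _ Finset.inter_subset_right _ Finset.inter_subset_right h

theorem ext_compl (l : ℕ) (A B : Finset V) :
    c.ext l A Bᶜ = c.ρ l (A ∩ G.O l) (G.O (l + 1) \ (B ∩ G.O (l + 1))) := by
  rw [ext, Finset.sdiff_inter_self_right, Finset.inter_comm Bᶜ, ← Finset.sdiff_eq_inter_compl]

/-- Extending a flow by one layer: if `f` obeys the bounds that `g` induces through the capacity
function of layer `l`, then it can be passed on to layer `l + 1` obeying the bounds `g`. -/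
theorem exists_next_layer {l : ℕ} (hl : l ∈ Finset.Ico 1 G.L) {g : Finset V → ℝ}
    (hg : IsPolymatroidRank g) {f : V → ℝ} (hf : ∀ v, 0 ≤ f v)
    (hfg : ∀ A U, ∑ v ∈ A, f v ≤ c.ext l A Uᶜ + g U) :
    ∃ x : V → ℝ, (∀ v, 0 ≤ x v) ∧ (∀ v ∉ G.O (l + 1), x v = 0) ∧ (∀ B, ∑ v ∈ B, x v ≤ g B) ∧
      (∀ A B, ∑ v ∈ B, x v ≤ c.ext l A B + ∑ v ∈ Aᶜ, f v) ∧ ∑ v, x v = ∑ v, f v := by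
  -- `x B ≤ h B` for all `B` encodes all capacity constraints of layer `l`. Complementing `A` turns
  -- the union/intersection pairing of bisubmodularity into joint submodularity.
  obtain ⟨h, hh, hle, hex⟩ := (isPolymatroidRank_sum hf).exists_minConvolution
    (ψ := fun B A => c.ext l Aᶜ B)
    (fun X Y A hXY => c.ext_mono hl le_rfl hXY)
    (fun X Y A B => by
      have := c.ext_bisubmodular hl Aᶜ Bᶜ X Y
      rw [← Finset.compl_inter, ← Finset.compl_union] at this
      linarith)
    (fun A => c.ext_eq_zero hl (Or.inr (Finset.empty_inter _)))
  obtain ⟨x, hx0, hxh, hxg, hxk⟩ := exists_le_inf_of_le_add_sdiff Finset.univ h g (∑ v, f v) hh hg (by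
    intro B _
    obtain ⟨A, hA⟩ := hex B
    have h1 := hfg Aᶜ Bᶜ
    rw [compl_compl] at h1
    have h2 := Finset.sum_add_sum_compl A f
    rw [← Finset.compl_eq_univ_sdiff]
    linarith)
  have hcap : ∀ A B, ∑ v ∈ B, x v ≤ c.ext l A B + ∑ v ∈ Aᶜ, f v := fun A B => by
    have := (hxh B (Finset.subset_univ B)).trans (hle B Aᶜ)
    rwa [compl_compl] at this
  refine ⟨x, hx0, ?_, fun B => hxg B (Finset.subset_univ B), hcap, le_antisymm ?_ hxk⟩
  · intro v hv
    have := hcap Finset.univ {v}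
    rw [c.ext_eq_zero hl (Or.inr (Finset.singleton_inter_of_notMem hv))] at this
    simp only [Finset.sum_singleton, Finset.compl_univ, Finset.sum_empty, add_zero] at this
    exact le_antisymm this (hx0 v)
  · have := hcap ∅ Finset.univ
    rwa [c.ext_eq_zero hl (Or.inl (Finset.empty_inter _)), zero_add, Finset.compl_empty] at this

/-- The minimal cut value from layer `l` on, as a function of the part of the cut in layer `l`
(cuts that contain the destination being charged `K`), bounds exactly the values on layer `l` that
extend to a flow on the later layers. -/
theorem exists_rank_of_layer (D : V) (hD : G.O G.L = {D}) (K : ℝ) (hK : 0 ≤ K) (n : ℕ) :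
    ∀ l, 1 ≤ l → l + n = G.L → ∃ g : Finset V → ℝ, IsPolymatroidRank g ∧
      (∀ W, ∃ Ω, Ω ∩ G.O l = W ∩ G.O l ∧
        ∑ j ∈ Finset.Ico l G.L, c.ext j Ω Ωᶜ + (if D ∈ Ω then K else 0) ≤ g W) ∧
      ∀ f : V → ℝ, (∀ v, 0 ≤ f v) → (∀ v ∉ G.O l, f v = 0) → (∀ W, ∑ v ∈ W, f v ≤ g W) →
        ∃ F : V → ℝ, (∀ v, 0 ≤ F v) ∧ (∀ v ∈ G.O l, F v = f v) ∧
          (∀ j ∈ Finset.Ico l G.L, ∀ A ⊆ G.O j, ∀ B ⊆ G.O (j + 1),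
            ∑ v ∈ B, F v - ∑ v ∈ G.O j \ A, F v ≤ c.ρ j A B) ∧
          ∑ v ∈ G.O l, F v = F D := by
  induction n with
  | zero =>
    rintro l hl rfl
    -- At the last layer no capacity remains, so only the charge `K` for containing `D` counts.
    have hmod := isPolymatroidRank_sum (f := fun v : V => if D = v then K else 0)
      (fun v => by split_ifs <;> simp [hK])
    refine ⟨_, hmod, fun W => ⟨W, rfl, ?_⟩, fun f hf _ _ => ⟨f, hf, fun _ _ => rfl, ?_, ?_⟩⟩
    · simp
    · simp
    · rw [hD, Finset.sum_singleton]
  | succ n ih =>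
    intro l hl hln
    obtain ⟨g, hg, hgcut, hgext⟩ := ih (l + 1) (by omega) (by omega)
    have hlL : l ∈ Finset.Ico 1 G.L := Finset.mem_Ico.2 ⟨hl, by omega⟩
    obtain ⟨q, hq, hqle, hqex⟩ := hg.exists_minConvolution (ψ := fun A U => c.ext l A Uᶜ)
      (fun X Y A hXY => c.ext_mono hlL hXY le_rfl)
      (fun X Y A B => by
        have := c.ext_bisubmodular hlL X Y Aᶜ Bᶜ
        rwa [← Finset.compl_inter, ← Finset.compl_union] at this)
      (fun A => c.ext_eq_zero hlL (Or.inl (Finset.empty_inter _)))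
    refine ⟨q, hq, ?_, ?_⟩
    · intro W
      obtain ⟨U, hU⟩ := hqex W
      obtain ⟨Ω, hΩU, hΩ⟩ := hgcut U
      -- The cut for `W` is the later cut `Ω` with its part in layer `l` replaced by that of `W`;
      -- the later terms do not see the change.
      have hmem : ∀ v, G.layerOf v ≠ l →
          (v ∈ (Ω \ G.O l) ∪ (W ∩ G.O l) ↔ v ∈ Ω) := by
        intro v hv
        simp [G.mem_O, hv]
      have hinter : ∀ j, j ≠ l → ((Ω \ G.O l) ∪ (W ∩ G.O l)) ∩ G.O j = Ω ∩ G.O j := by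
        intro j hj
        ext v
        simp only [Finset.mem_inter (s₂ := G.O j), and_congr_left_iff]
        intro hv
        exact hmem v (by rw [G.mem_O.1 hv]; exact hj)
      refine ⟨(Ω \ G.O l) ∪ (W ∩ G.O l), ?_, ?_⟩
      · ext v; simp only [Finset.mem_inter, Finset.mem_union, Finset.mem_sdiff]; tauto
      · have hDl : G.layerOf D ≠ l := by
          have : D ∈ G.O G.L := by rw [hD]; exact Finset.mem_singleton_self D
          rw [G.mem_O.1 this]; omega
        rw [Finset.sum_eq_sum_Ico_succ_bot (by omega)]
        have h1 : ∑ j ∈ Finset.Ico (l + 1) G.L,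
            c.ext j ((Ω \ G.O l) ∪ (W ∩ G.O l)) ((Ω \ G.O l) ∪ (W ∩ G.O l))ᶜ =
            ∑ j ∈ Finset.Ico (l + 1) G.L, c.ext j Ω Ωᶜ := by
          refine Finset.sum_congr rfl fun j hj => ?_
          have hj := (Finset.mem_Ico.1 hj).1
          rw [ext_compl, ext_compl, hinter j (by omega), hinter (j + 1) (by omega)]
        have h2 : c.ext l ((Ω \ G.O l) ∪ (W ∩ G.O l)) ((Ω \ G.O l) ∪ (W ∩ G.O l))ᶜ =
            c.ext l W Uᶜ := by
          rw [ext_compl, ext_compl, hinter (l + 1) (by omega), hΩU]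
          congr 1
          ext v; simp only [Finset.mem_inter, Finset.mem_union, Finset.mem_sdiff]; tauto
        rw [h1, h2, hU]
        simp only [hmem D hDl]
        linarith
    · intro f hf hfsupp hfq
      obtain ⟨x, hx0, hxsupp, hxg, hxcap, hxsum⟩ := c.exists_next_layer hlL hg hf
        (fun A U => (hfq A).trans (hqle A U))
      obtain ⟨F, hF0, hFx, hFcap, hFsink⟩ := hgext x hx0 hxsupp hxg
      have hl' : ∀ j, l < j → ∀ B ⊆ G.O j,
          ∑ v ∈ B, (if v ∈ G.O l then f v else F v) = ∑ v ∈ B, F v := by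
        intro j hj B hB
        refine Finset.sum_congr rfl fun v hv => if_neg fun hvl => ?_
        have h1 := G.mem_O.1 hvl
        have h2 := G.mem_O.1 (hB hv)
        omega
      have hfl : ∀ B ⊆ G.O l, ∑ v ∈ B, (if v ∈ G.O l then f v else F v) = ∑ v ∈ B, f v :=
        fun B hB => Finset.sum_congr rfl fun v hv => if_pos (hB hv)
      refine ⟨fun v => if v ∈ G.O l then f v else F v, ?_, fun v hv => if_pos hv, ?_, ?_⟩
      · intro v
        dsimp only
        split_ifs
        exacts [hf v, hF0 v]
      · intro j hj A hA B hB
        rw [Finset.mem_Ico] at hj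
        rcases hj.1.eq_or_lt with rfl | hlj
        · rw [hl' (l + 1) (by omega) B hB, hfl _ Finset.sdiff_subset,
            Finset.sum_congr rfl fun v hv => hFx v (hB hv)]
          have h1 := hxcap A B
          have h2 : ∑ v ∈ Aᶜ, f v = ∑ v ∈ G.O l \ A, f v := by
            refine (Finset.sum_subset ?_ ?_).symm
            · intro v hv; simp only [Finset.mem_sdiff, Finset.mem_compl] at hv ⊢; exact hv.2
            · intro v hv hv'
              simp only [Finset.mem_sdiff, Finset.mem_compl] at hv hv'
              exact hfsupp v fun h => hv' ⟨h, hv⟩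
          rw [ext, Finset.inter_eq_left.2 hA, Finset.inter_eq_left.2 hB] at h1
          linarith
        · rw [hl' (j + 1) (by omega) B hB, hl' j hlj _ Finset.sdiff_subset]
          exact hFcap j (Finset.mem_Ico.2 ⟨hlj, hj.2⟩) A hA B hB
      · have h1 := hl' G.L (by omega) {D} hD.ge
        rw [Finset.sum_singleton, Finset.sum_singleton] at h1
        rw [hfl _ le_rfl]
        refine Eq.trans ?_ h1.symm
        rw [← hFsink, Finset.sum_congr rfl hFx,
          Finset.sum_subset (Finset.subset_univ _) fun v _ hv => hfsupp v hv, ← hxsum]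
        exact (Finset.sum_subset (Finset.subset_univ _) fun v _ hv => hxsupp v hv).symm

theorem cut_eq_sum_ext (Ω : Finset V) :
    c.cut Ω = ∑ j ∈ Finset.Ico 1 G.L, c.ext j Ω Ωᶜ :=
  Finset.sum_congr rfl fun j _ => (c.ext_compl j Ω Ω).symm

theorem cut_nonneg (Ω : Finset V) : 0 ≤ c.cut Ω :=
  Finset.sum_nonneg fun j hj =>
    c.nonneg j hj _ Finset.inter_subset_right _ Finset.sdiff_subset

/-- The flow out of the source part of a cut is bounded by the value of the cut. -/
theorem IsNodeFlow.sum_le_cut {c : BisubmodularCapacity G} {D : V} (hD : G.O G.L = {D})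
    {f : V → ℝ} (hf : c.IsNodeFlow D f) {Ω : Finset V} (hΩ : D ∉ Ω) :
    ∑ v ∈ Ω ∩ G.O 1, f v ≤ c.cut Ω := by
  have hL : 1 ≤ G.L := (G.one_le_layerOf D).trans (G.layerOf_le D)
  -- The left side telescopes to `f D` minus the flow of the sources outside `Ω`.
  have h1 : ∑ l ∈ Finset.Ico 1 G.L, (∑ v ∈ G.O (l + 1) \ (Ω ∩ G.O (l + 1)), f v -
      ∑ v ∈ G.O l \ (Ω ∩ G.O l), f v) ≤ c.cut Ω :=
    Finset.sum_le_sum fun l hl =>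
      hf.capacity l hl _ Finset.inter_subset_right _ Finset.sdiff_subset
  rw [Finset.sum_Ico_sub (fun l => ∑ v ∈ G.O l \ (Ω ∩ G.O l), f v) hL, hD,
    Finset.inter_singleton_of_notMem hΩ, Finset.sdiff_empty, Finset.sum_singleton,
    ← hf.sink] at h1
  have h2 := Finset.sum_sdiff (f := f) (Finset.inter_subset_right (s₁ := Ω) (s₂ := G.O 1))
  linarith

end BisubmodularCapacity

theorem mainTheorem7 {V : Type*} [Fintype V] [DecidableEq V] (G : LayeredGraph V)
    (c : BisubmodularCapacity G) (D : V) (hD : G.O G.L = {D})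
    (s : {v // v ∈ G.O 1} → ℝ) (hs : ∀ v, 0 ≤ s v) :
    c.Feasible D s ↔
      ∀ Ω : Finset V, D ∉ Ω → ∑ v : {v // v ∈ G.O 1} with v.1 ∈ Ω, s v ≤ c.cut Ω := by
  have hsum : ∀ f : V → ℝ, (∀ v : {v // v ∈ G.O 1}, f v = s v) → ∀ Ω : Finset V,
      ∑ v : {v // v ∈ G.O 1} with v.1 ∈ Ω, s v = ∑ v ∈ Ω ∩ G.O 1, f v := by
    intro f hf Ω
    rw [Finset.inter_comm, Finset.sum_filter, ← Finset.sum_ite_mem, ← Finset.sum_coe_sort (G.O 1)]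
    exact Finset.sum_congr rfl fun v _ => by rw [hf v]
  constructor
  · rintro ⟨f, hf, hfs⟩ Ω hΩ
    rw [hsum f hfs]
    exact hf.sum_le_cut hD hΩ
  · intro hcut
    have hL : 1 ≤ G.L := (G.one_le_layerOf D).trans (G.layerOf_le D)
    set f : V → ℝ := fun v => if h : v ∈ G.O 1 then s ⟨v, h⟩ else 0 with hfdef
    have hfs : ∀ v : {v // v ∈ G.O 1}, f v = s v := fun v => dif_pos v.2
    have hfsupp : ∀ v ∉ G.O 1, f v = 0 := fun v hv => dif_neg hv
    have hf0 : ∀ v, 0 ≤ f v := by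
      intro v
      by_cases hv : v ∈ G.O 1
      · exact (hs ⟨v, hv⟩).trans (hfs ⟨v, hv⟩).ge
      · exact (hfsupp v hv).ge
    -- With `K` the total source value, cuts containing `D` impose no restriction.
    obtain ⟨g, -, hgcut, hgext⟩ := c.exists_rank_of_layer D hD (∑ v, f v)
      (Finset.sum_nonneg fun v _ => hf0 v) (G.L - 1) 1 le_rfl (by omega)
    obtain ⟨F, hF0, hFf, hFcap, hFsink⟩ := hgext f hf0 hfsupp (by
      intro W
      obtain ⟨Ω, hΩW, hΩ⟩ := hgcut W
      rw [← c.cut_eq_sum_ext] at hΩ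
      refine le_trans ?_ hΩ
      by_cases hDΩ : D ∈ Ω
      · rw [if_pos hDΩ]
        have h1 := Finset.sum_le_sum_of_subset_of_nonneg (Finset.subset_univ W)
          (fun v _ _ => hf0 v)
        linarith [c.cut_nonneg Ω]
      · rw [if_neg hDΩ, add_zero]
        have h1 := hcut Ω hDΩ
        rw [hsum f hfs, hΩW] at h1
        refine le_trans (Finset.sum_subset Finset.inter_subset_left ?_).ge h1
        intro v hv hv'
        exact hfsupp v fun h => hv' (Finset.mem_inter.2 ⟨hv, h⟩))
    exact ⟨F, ⟨hF0, hFcap, hFsink⟩, fun v => (hFf v v.2).trans (hfs v)⟩
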